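/- Let $R$ be a (unital, associative) ring that is von Neumann regular and right semiartinian. Here the Loewy chain of the right module $R_R$ is defined by $L_0=0$, $L_{\gamma+1}/L_\gamma=\operatorname{Soc}(R/L_\gamma)$, and $L_\gamma=\bigcup_{\delta<\gamma}L_\delta$ for limit $\gamma$, and $R$ is right semiartinian if $L_\xi=R$ for some ordinal $\xi$. For a right $R$-module $M$ put $h(M)=\min\{\gamma : ML_\gamma=M\}$. For simple right $R$-modules $U,V$ write $U\preccurlyeq V$ if $r_R(U)\subseteq r_R(V)$, where $r_R$ denotes the annihilator in $R$ (the natural preorder), and $U\prec V$ if $U\preccurlyeq V$ but not $V\preccurlyeq U$. Write $M\lesssim N$ if $M$ is isomorphic to a submodule of $N$. Let $U,V$ be simple right $R$-modules with $\alpha+1=h(U)<h(V)=\beta+1$. Then the following conditions are equivalent: 1. $U\prec V$. 2. For every $y\in L_{\beta+1}\setminus L_\beta$ with $(yR+L_\beta)/L_\beta\cong V$, one has $U^n\lesssim (yR+L_\alpha)/L_\alpha$ for every positive integer $n$. 3. For every $y\in L_{\beta+1}\setminus L_\beta$ with $(yR+L_\beta)/L_\beta\cong V$ and every positive integer $n$,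 there is $x\in L_{\alpha+1}\setminus L_\alpha$ such that $(xR+L_\alpha)/L_\alpha\cong U$ and $(xR)^n\lesssim yR$, where $(xR)^n$ is the direct sum of $n$ copies of $xR$. 4. For every $y\in L_{\beta+1}\setminus L_\beta$ with $(yR+L_\beta)/L_\beta\cong V$, there is $x\in L_{\alpha+1}\setminus L_\alpha$ such that $(xR+L_\alpha)/L_\alpha\cong U$ and $RxR\subseteq RyR$. Moreover, the elements $x,y$ can be chosen idempotent: there exist idempotents $x\in L_{\alpha+1}\setminus L_\alpha$ and $y\in L_{\beta+1}\setminus L_\beta$ with $(xR+L_\alpha)/L_\alpha\cong U$ and $(yR+L_\beta)/L_\beta\cong V$, and the equivalence remains true if, independently, the quantifier over $y$ in (2)-(4) is restricted to idempotents and $x$ in (3), (4) is required to be idempotent. -/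

import Mathlib

universe u v w

/-! Right `R`-modules are modules over `Rᵐᵒᵖ`; the right ideals of `R` are the terms of
`Submodule Rᵐᵒᵖ R`. -/

namespace Semiart

section Loewy

/-- The socle of a module: the sum of all its simple submodules. -/
def socle (A : Type u) [Ring A] (M : Type v) [AddCommGroup M] [Module A M] : Submodule A M :=
  sSup {S : Submodule A M | IsSimpleModule A S}

/-- The Loewy chain of a module: `Soc_0 M = 0`, `Soc_{α+1} M / Soc_α M = Soc (M / Soc_α M)`, and
`Soc_α M` is the union (the supremum) of the earlier terms if `α` is a limit ordinal. -/
noncomputable def loewy (A : Type u) [Ring A] (M : Type v) [AddCommGroup M] [Module A M]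
    (α : Ordinal.{w}) : Submodule A M :=
  Ordinal.limitRecOn (motive := fun _ => Submodule A M) α ⊥
    (fun _ N => (socle A (M ⧸ N)).comap N.mkQ)
    (fun γ _ ih => ⨆ δ : Set.Iio γ, ih δ.1 δ.2)

theorem loewy_zero (A : Type u) [Ring A] (M : Type v) [AddCommGroup M] [Module A M] :
    loewy A M (0 : Ordinal.{w}) = ⊥ := by
  simp [loewy]

theorem loewy_add_one (A : Type u) [Ring A] (M : Type v) [AddCommGroup M] [Module A M]
    (α : Ordinal.{w}) :
    loewy A M (α + 1) = (socle A (M ⧸ loewy A M α)).comap (loewy A M α).mkQ := by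
  exact Ordinal.limitRecOn_add_one ..

theorem loewy_limit (A : Type u) [Ring A] (M : Type v) [AddCommGroup M] [Module A M]
    {α : Ordinal.{w}} (hα : Order.IsSuccLimit α) :
    loewy A M α = ⨆ δ : Set.Iio α, loewy A M δ.1 := by
  exact Ordinal.limitRecOn_limit _ _ _ _ hα

end Loewy

section Ring

variable (R : Type u) [Ring R]

/-- Von Neumann regular rings. -/
def IsRegularRing : Prop := ∀ a : R, ∃ b : R, a * b * a = a

/-- `L R α = Soc_α(R_R)`, the `α`-th term of the Loewy chain of the right module `R_R`. -/
noncomputable def L (α : Ordinal.{u}) : Submodule Rᵐᵒᵖ R := loewy Rᵐᵒᵖ R α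

/-- `R` is right semiartinian: the Loewy chain of `R_R` reaches `R`. -/
def IsRightSemiartinian : Prop := ∃ ξ : Ordinal.{u}, L R ξ = ⊤

/-- The submodule `M · I` of a right module `M`, generated by all `m · r` with `m ∈ M`, `r ∈ I`. -/
def mulIdeal (M : Type v) [AddCommGroup M] [Module Rᵐᵒᵖ M] (I : Submodule Rᵐᵒᵖ R) :
    Submodule Rᵐᵒᵖ M :=
  Submodule.span Rᵐᵒᵖ {z | ∃ m : M, ∃ r ∈ I, z = MulOpposite.op r • m}

/-- `h(M)`, the least ordinal `α` such that `M · Soc_α(R_R) = M`. -/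
noncomputable def h (M : Type v) [AddCommGroup M] [Module Rᵐᵒᵖ M] : Ordinal.{u} :=
  sInf {α : Ordinal.{u} | mulIdeal R M (L R α) = ⊤}

/-- The natural preorder on simple right modules over a semiartinian regular ring:
`U ≼ V` if and only if `r_R(U) ⊆ r_R(V)`, with `r_R` the annihilator in `R`. -/
def NatLE (U : Type v) [AddCommGroup U] [Module Rᵐᵒᵖ U]
    (V : Type w) [AddCommGroup V] [Module Rᵐᵒᵖ V] : Prop :=
  Module.annihilator Rᵐᵒᵖ U ≤ Module.annihilator Rᵐᵒᵖ V

/-- The strict relation `U ≺ V` of the natural preorder. -/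
def NatLT (U : Type v) [AddCommGroup U] [Module Rᵐᵒᵖ U]
    (V : Type w) [AddCommGroup V] [Module Rᵐᵒᵖ V] : Prop :=
  NatLE R U V ∧ ¬ NatLE R V U

variable {R}

/-- The principal right ideal `xR`. -/
def principal (x : R) : Submodule Rᵐᵒᵖ R := Submodule.span Rᵐᵒᵖ {x}

/-- The module `(xR + L_α) / L_α`, as a submodule of `R / L_α`. -/
noncomputable def principalMod (x : R) (α : Ordinal.{u}) : Submodule Rᵐᵒᵖ (R ⧸ L R α) :=
  (principal x ⊔ L R α).map (L R α).mkQ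

/-- `x ∈ L_{α+1} \ L_α` and `(xR + L_α) / L_α ≅ W`. -/
def Represents (x : R) (α : Ordinal.{u}) (W : Type v) [AddCommGroup W] [Module Rᵐᵒᵖ W] : Prop :=
  x ∈ L R (α + 1) ∧ x ∉ L R α ∧ Nonempty (principalMod x α ≃ₗ[Rᵐᵒᵖ] W)

/-- `M ≲ N`: the module `M` is isomorphic to a submodule of `N`. -/
def Embeds (A : Type u) [Ring A] (M : Type v) [AddCommGroup M] [Module A M]
    (N : Type w) [AddCommGroup N] [Module A N] : Prop :=
  ∃ f : M →ₗ[A] N, Function.Injective f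

end Ring

end Semiart

open MulOpposite

/-! Each term `L R γ` is a two-sided ideal; `L R (α + 1)` kills `V` because `α + 1 ≤ β`, while a
representative of `U` lies in it and does not kill `U`. So `V ≼ U` never holds, and `U ≺ V` just
says `r(U) ⊆ r(V)`.

If `r(U) ⊆ r(V)` and `g` does not kill `V`, then `g` does not kill `U`, so `gR` contains a right
ideal `zR` with `z` representing `U`. By regularity `zR` splits off, and the rest of `gR` still acts
nontrivially on `V` since `z ∈ L R (α + 1)` kills `V`. Iteration gives any number of independent
copies (`exists_independent_copies`), which is (3). Regularity carries embeddings down modulo `L R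
α` (`Embeds.principalMod`) and puts `x` into `RyR` (`mem_span_of_embeds`).

If some `a` kills `U` but not `V`, then `aR` contains a representative `y` of `V` killing `U`; this
`y` refutes both (2) and (4). -/

namespace Semiart

/-! ### Functoriality and monotonicity of the Loewy chain. -/

section Loewy

variable {A : Type u} [Ring A] {M : Type v} [AddCommGroup M] [Module A M]

/-- Homomorphisms map the socle into the socle. -/
theorem socle_le_comap {N : Type w} [AddCommGroup N] [Module A N] (f : M →ₗ[A] N) :
    socle A M ≤ (socle A N).comap f := by
  refine sSup_le fun S (hS : IsSimpleModule A S) => ?_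
  rw [← Submodule.map_le_iff_le_comap]
  rcases (f ∘ₗ S.subtype).injective_or_eq_zero with hf | hf
  · refine le_sSup ?_
    have e := LinearEquiv.ofInjective _ hf
    rw [LinearMap.range_comp, Submodule.range_subtype] at e
    exact IsSimpleModule.congr e.symm
  · have : S.map f = ⊥ := by
      rw [← LinearMap.range_eq_bot.mpr hf, LinearMap.range_comp, Submodule.range_subtype]
    rw [this]
    exact bot_le

theorem loewy_le_add_one (α : Ordinal.{w}) : loewy A M α ≤ loewy A M (α + 1) := by
  rw [loewy_add_one]
  exact Submodule.le_comap_mkQ _ _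

theorem loewy_mono : Monotone (loewy A M : Ordinal.{w} → Submodule A M) := by
  intro α β hαβ
  induction β using Ordinal.limitRecOn with
  | zero =>
    obtain rfl : α = 0 := le_antisymm hαβ zero_le
    exact le_rfl
  | add_one β ih =>
    rcases hαβ.eq_or_lt with rfl | hlt
    · exact le_rfl
    · exact (ih (Order.lt_add_one_iff.mp hlt)).trans (loewy_le_add_one β)
  | limit β hβ ih =>
    rcases hαβ.eq_or_lt with rfl | hlt
    · exact le_rfl
    · rw [loewy_limit A M hβ]
      exact le_iSup (fun δ : Set.Iio β => loewy A M δ.1) ⟨α, hlt⟩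

/-- The terms of the Loewy chain are fully invariant. -/
theorem loewy_le_comap (f : M →ₗ[A] M) (α : Ordinal.{w}) :
    loewy A M α ≤ (loewy A M α).comap f := by
  induction α using Ordinal.limitRecOn with
  | zero => simp [loewy_zero]
  | add_one β ih =>
    rw [loewy_add_one]
    intro m hm
    exact socle_le_comap (Submodule.mapQ _ _ f ih) hm
  | limit β hβ ih =>
    rw [loewy_limit A M hβ]
    refine iSup_le fun δ => (ih δ.1 δ.2).trans (Submodule.comap_mono ?_)
    exact le_iSup (fun δ : Set.Iio β => loewy A M δ.1) δ

end Loewy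

/-! ### Principal right ideals and their images modulo the Loewy ideals. -/

section Ring

variable {R : Type u} [Ring R]

theorem mem_principal {x z : R} : z ∈ principal x ↔ ∃ s, z = x * s := by
  rw [principal, Submodule.mem_span_singleton]
  constructor
  · rintro ⟨a, rfl⟩
    exact ⟨unop a, rfl⟩
  · rintro ⟨s, rfl⟩
    exact ⟨op s, rfl⟩

theorem mul_mem_principal (x s : R) : x * s ∈ principal x := mem_principal.mpr ⟨s, rfl⟩

theorem self_mem_principal (x : R) : x ∈ principal x := Submodule.mem_span_singleton_self x

theorem principal_le {x : R} {I : Submodule Rᵐᵒᵖ R} : principal x ≤ I ↔ x ∈ I :=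
  Submodule.span_singleton_le_iff_mem x I

theorem mul_mem_right {I : Submodule Rᵐᵒᵖ R} {x : R} (hx : x ∈ I) (s : R) : x * s ∈ I :=
  I.smul_mem (op s) hx

/-- Left multiplications are endomorphisms of `R_R`, so full invariance makes `L R α` two-sided. -/
theorem mul_mem_L {α : Ordinal.{u}} {x : R} (t : R) (hx : x ∈ L R α) : t * x ∈ L R α :=
  loewy_le_comap (LinearMap.mulLeft Rᵐᵒᵖ t) α hx

/-- Left multiplication by `t` on `R / L_α`. -/
noncomputable def leftMul (t : R) (α : Ordinal.{u}) : (R ⧸ L R α) →ₗ[Rᵐᵒᵖ] (R ⧸ L R α) :=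
  Submodule.mapQ _ _ (LinearMap.mulLeft Rᵐᵒᵖ t) (loewy_le_comap (LinearMap.mulLeft Rᵐᵒᵖ t) α)

theorem principalMod_eq_span (x : R) (α : Ordinal.{u}) :
    principalMod x α = Submodule.span Rᵐᵒᵖ {(L R α).mkQ x} := by
  rw [principalMod, Submodule.map_sup, principal, Submodule.map_span, Set.image_singleton]
  simp

theorem mkQ_mem_principalMod (x : R) (α : Ordinal.{u}) : (L R α).mkQ x ∈ principalMod x α := by
  rw [principalMod_eq_span]
  exact Submodule.mem_span_singleton_self _

theorem mem_principalMod {x : R} {α : Ordinal.{u}} {q : R ⧸ L R α} :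
    q ∈ principalMod x α ↔ ∃ s, q = (L R α).mkQ (x * s) := by
  rw [principalMod_eq_span, Submodule.mem_span_singleton]
  constructor
  · rintro ⟨a, rfl⟩
    exact ⟨unop a, rfl⟩
  · rintro ⟨s, rfl⟩
    exact ⟨op s, rfl⟩

theorem mkQ_eq_zero {x : R} {α : Ordinal.{u}} : (L R α).mkQ x = 0 ↔ x ∈ L R α := by
  rw [Submodule.mkQ_apply, Submodule.Quotient.mk_eq_zero]

theorem principalMod_congr {x z : R} (hxz : principal x = principal z) (α : Ordinal.{u}) :
    principalMod x α = principalMod z α := by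
  rw [principalMod, hxz, principalMod]

theorem Represents.congr {x z : R} {α : Ordinal.{u}} {W : Type v} [AddCommGroup W]
    [Module Rᵐᵒᵖ W] (hx : Represents x α W) (hxz : principal z = principal x) :
    Represents z α W := by
  refine ⟨?_, fun hz => hx.2.1 ?_, ?_⟩
  · rw [← principal_le, hxz, principal_le]
    exact hx.1
  · rwa [← principal_le, ← hxz, principal_le]
  · rw [principalMod_congr hxz]
    exact hx.2.2

/-- Every principal right ideal of a regular ring is generated by an idempotent. -/
theorem exists_idempotent_principal_eq (hreg : IsRegularRing R) (x : R) :
    ∃ e : R, IsIdempotentElem e ∧ principal e = principal x := by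
  obtain ⟨x', hx'⟩ := hreg x
  refine ⟨x * x', ?_, le_antisymm ?_ ?_⟩
  · rw [IsIdempotentElem, ← mul_assoc, hx']
  · exact principal_le.mpr (mul_mem_principal x x')
  · exact principal_le.mpr (mem_principal.mpr ⟨x, hx'.symm⟩)

/-! ### Representatives of simple modules. -/

section Simple

variable {W : Type v} [AddCommGroup W] [Module Rᵐᵒᵖ W] {α : Ordinal.{u}}

/-- The orbit map `s ↦ w s` of an element of a right module. -/
def orbit (w : W) : R →ₗ[Rᵐᵒᵖ] W where
  toFun s := op s • w
  map_add' a b := by rw [op_add, add_smul]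
  map_smul' a b := by
    rw [RingHom.id_apply, smul_smul]
    rfl

/-- `W` embeds in `R / L_α`, which the two-sided ideal `L R α` annihilates. -/
theorem Represents.smul_eq_zero {x : R} (hx : Represents x α W) {r : R} (hr : r ∈ L R α) (w : W) :
    op r • w = 0 := by
  obtain ⟨e⟩ := hx.2.2
  rw [← e.symm.map_eq_zero_iff, map_smul]
  obtain ⟨s, hs⟩ := mem_principalMod.mp (e.symm w).2
  refine Subtype.ext ?_
  rw [Submodule.coe_smul, hs, ← map_smul]
  exact mkQ_eq_zero.mpr (mul_mem_L _ hr)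

theorem Represents.exists_smul_ne_zero (hreg : IsRegularRing R) {x : R}
    (hx : Represents x α W) : ∃ w : W, op x • w ≠ 0 := by
  obtain ⟨e⟩ := hx.2.2
  obtain ⟨x', hx'⟩ := hreg x
  -- The witness is the image of the class of `x x'`; multiplying it by `x` gives the image of `x x'
  -- x = x`, nonzero modulo `L R α`.
  refine ⟨op x' • e ⟨_, mkQ_mem_principalMod x α⟩, fun h0 => hx.2.1 ?_⟩
  rw [smul_smul, ← op_mul, ← map_smul, e.map_eq_zero_iff] at h0
  have h1 := congrArg Subtype.val h0
  rw [Submodule.coe_smul, ← map_smul, op_smul_eq_mul, ← mul_assoc, hx'] at h1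
  exact mkQ_eq_zero.mp h1

variable [IsSimpleModule Rᵐᵒᵖ W]

theorem Represents.isSimpleModule {x : R} (hx : Represents x α W) :
    IsSimpleModule Rᵐᵒᵖ (principalMod x α) :=
  let ⟨e⟩ := hx.2.2
  IsSimpleModule.congr e

theorem Represents.of_mem_principal {x z : R} (hx : Represents x α W) (hz : z ∈ principal x)
    (hzL : z ∉ L R α) : Represents z α W := by
  have := hx.isSimpleModule
  refine ⟨principal_le.mpr hx.1 hz, hzL, ?_⟩
  have hle : principalMod z α ≤ principalMod x α :=
    Submodule.map_mono (sup_le_sup_right (principal_le.mpr hz) _)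
  have heq : principalMod z α = principalMod x α := by
    refine ((isSimpleModule_iff_isAtom.mp this).le_iff.mp hle).resolve_left fun h0 => hzL ?_
    have h1 := mkQ_mem_principalMod z α
    rw [h0, Submodule.mem_bot] at h1
    exact mkQ_eq_zero.mp h1
  rw [heq]
  exact hx.2.2

/-- Schur: left multiplication by `t` on the simple module `principalMod x α` is injective or zero.
-/
theorem Represents.mul_left {x : R} (hx : Represents x α W) {t : R} (htx : t * x ∉ L R α) :
    Represents (t * x) α W := by
  have := hx.isSimpleModule
  refine ⟨mul_mem_L t hx.1, htx, ?_⟩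
  obtain ⟨e⟩ := hx.2.2
  have hmap : (principalMod x α).map (leftMul t α) = principalMod (t * x) α := by
    rw [principalMod_eq_span, principalMod_eq_span, Submodule.map_span, Set.image_singleton]
    rfl
  rcases (leftMul t α ∘ₗ (principalMod x α).subtype).injective_or_eq_zero with hf | hf
  · have e' := LinearEquiv.ofInjective _ hf
    rw [LinearMap.range_comp, Submodule.range_subtype, hmap] at e'
    exact ⟨e'.symm.trans e⟩
  · exact absurd (mkQ_eq_zero.mp (LinearMap.congr_fun hf ⟨_, mkQ_mem_principalMod x α⟩)) htx

/-- If `a` does not annihilate `W`, then `aR` contains a representative of `W`. -/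
theorem Represents.exists_mul_mul (hreg : IsRegularRing R) {x a : R} (hx : Represents x α W)
    {w : W} (ha : op a • w ≠ 0) : ∃ r : R, Represents (a * r * x) α W := by
  obtain ⟨w₀, hw₀⟩ := hx.exists_smul_ne_zero hreg
  -- As `wa` generates `W`, some `b` gives `wab = w₀`, so `abx` does not kill `w` and hence lies
  -- outside `L R α`.
  obtain ⟨b, hb⟩ := IsSimpleModule.toSpanSingleton_surjective Rᵐᵒᵖ ha w₀
  rw [LinearMap.toSpanSingleton_apply] at hb
  refine ⟨unop b, hx.mul_left fun hL => hw₀ ?_⟩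
  rw [← hb, smul_smul, smul_smul]
  have h0 := hx.smul_eq_zero hL w
  rwa [op_mul, op_mul, op_unop, ← mul_assoc] at h0

/-- A simple module `W` with `h(W) = α + 1` is represented by some element. -/
theorem exists_represents (hW : h R W = α + 1) : ∃ x : R, Represents x α W := by
  -- An infimum over the empty set would be `0`, which is not a successor.
  have hne : {γ : Ordinal.{u} | mulIdeal R W (L R γ) = ⊤}.Nonempty := by
    by_contra hemp
    rw [Set.not_nonempty_iff_eq_empty] at hemp
    rw [h, hemp, Ordinal.sInf_empty] at hW
    exact (Order.succ_ne_bot α) hW.symm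
  have htop : mulIdeal R W (L R (α + 1)) = ⊤ := by
    have := csInf_mem hne
    rwa [← h, hW] at this
  have hbot : mulIdeal R W (L R α) = ⊥ :=
    (eq_bot_or_eq_top _).resolve_right fun htop' => by
      have : h R W ≤ α := csInf_le' htop'
      rw [hW] at this
      exact (Order.lt_add_one_iff.mpr le_rfl).not_ge this
  obtain ⟨w, r, hr, hwr⟩ : ∃ w : W, ∃ r ∈ L R (α + 1), op r • w ≠ 0 := by
    by_contra! hcon
    refine bot_ne_top (α := Submodule Rᵐᵒᵖ W) (eq_top_iff.mpr (htop.ge.trans ?_))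
    refine Submodule.span_le.mpr ?_
    rintro _ ⟨w, r, hr, rfl⟩
    exact hcon w r hr
  have hker : L R α ≤ LinearMap.ker (orbit w) := fun s hs => by
    have : op s • w ∈ mulIdeal R W (L R α) := Submodule.subset_span ⟨w, s, hs, rfl⟩
    rwa [hbot] at this
  set φ := (L R α).liftQ (orbit w) hker with hφ
  -- `φ` is nonzero on the socle of `R / L_α`, hence on some simple submodule, which it maps
  -- isomorphically onto `W`.
  obtain ⟨S, hS, hSφ⟩ : ∃ S : Submodule Rᵐᵒᵖ (R ⧸ L R α), IsSimpleModule Rᵐᵒᵖ S ∧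
      ¬ S ≤ LinearMap.ker φ := by
    by_contra! hcon
    rw [L, loewy_add_one] at hr
    exact hwr ((sSup_le hcon : socle Rᵐᵒᵖ (R ⧸ L R α) ≤ LinearMap.ker φ) hr)
  obtain ⟨q, hqS, hq⟩ := SetLike.not_le_iff_exists.mp hSφ
  obtain ⟨x, rfl⟩ := (L R α).mkQ_surjective q
  have hxL : x ∉ L R α := fun hx => hq (by rw [mkQ_eq_zero.mpr hx]; exact zero_mem _)
  have hxS : principalMod x α = S := by
    have hle : principalMod x α ≤ S := by
      rw [principalMod_eq_span]
      exact (Submodule.span_singleton_le_iff_mem _ _).mpr hqS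
    refine ((isSimpleModule_iff_isAtom.mp hS).le_iff.mp hle).resolve_left fun h0 => hxL ?_
    have h1 := mkQ_mem_principalMod x α
    rw [h0, Submodule.mem_bot] at h1
    exact mkQ_eq_zero.mp h1
  refine ⟨x, ?_, hxL, ?_⟩
  · rw [L, loewy_add_one]
    exact (le_sSup hS : S ≤ socle Rᵐᵒᵖ (R ⧸ L R α)) hqS
  · rw [hxS]
    rcases (φ ∘ₗ S.subtype).bijective_or_eq_zero with hb | h0
    · exact ⟨LinearEquiv.ofBijective _ hb⟩
    · exact absurd (LinearMap.congr_fun h0 ⟨_, hqS⟩) hq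

end Simple

/-! ### Annihilators, and recovering elements from their images by regularity. -/

theorem mem_annihilator {W : Type v} [AddCommGroup W] [Module Rᵐᵒᵖ W] {a : R} :
    op a ∈ Module.annihilator Rᵐᵒᵖ W ↔ ∀ w : W, op a • w = 0 :=
  Module.mem_annihilator

theorem smul_mul_eq_zero {W : Type v} [AddCommGroup W] [Module Rᵐᵒᵖ W] {a : R}
    (ha : ∀ w : W, op a • w = 0) (s : R) (w : W) : op (a * s) • w = 0 := by
  rw [op_mul, mul_smul, ha, smul_zero]

theorem smul_mul_eq_zero' {W : Type v} [AddCommGroup W] [Module Rᵐᵒᵖ W] {a : R}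
    (ha : ∀ w : W, op a • w = 0) (s : R) (w : W) : op (s * a) • w = 0 := by
  rw [op_mul, mul_smul, ha]

/-- Elements of the ideal generated by `y` annihilate every module that `y` annihilates. -/
theorem smul_eq_zero_of_mem_span {W : Type v} [AddCommGroup W] [Module Rᵐᵒᵖ W] {y z : R}
    (hy : ∀ w : W, op y • w = 0) (hz : z ∈ TwoSidedIdeal.span {y}) (w : W) : op z • w = 0 := by
  let I : TwoSidedIdeal R := TwoSidedIdeal.mk' {a | ∀ w : W, op a • w = 0}
    (fun w => by simp) (fun ha hb w => by rw [op_add, add_smul, ha, hb, add_zero])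
    (fun ha w => by rw [op_neg, neg_smul, ha, neg_zero])
    (fun ha => smul_mul_eq_zero' ha _) (fun ha => smul_mul_eq_zero ha _)
  have hI : z ∈ I := TwoSidedIdeal.mem_span_iff.mp hz I (by
    rw [Set.singleton_subset_iff]
    exact (TwoSidedIdeal.mem_mk' _ _ _ _ _ _ _).mpr hy)
  exact (TwoSidedIdeal.mem_mk' _ _ _ _ _ _ _).mp hI w

/-- In a regular ring, a monomorphism `f` from `P` to a right ideal recovers each `p` from its image:
`p = p w f(p)` for some `w`. -/
theorem exists_smul_eq_self (hreg : IsRegularRing R) {P : Type v} [AddCommGroup P] [Module Rᵐᵒᵖ P]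
    {I : Submodule Rᵐᵒᵖ R} {f : P →ₗ[Rᵐᵒᵖ] I} (hf : Function.Injective f) (p : P) :
    ∃ w' : R, op (w' * (f p : R)) • p = p := by
  obtain ⟨w', hw'⟩ := hreg (f p : R)
  refine ⟨w', hf (Subtype.ext ?_)⟩
  rw [map_smul, Submodule.coe_smul, op_smul_eq_mul, ← mul_assoc, hw']

/-! ### Copies of `U` inside `yR`, and obstructions to them. -/

section Main

variable {U : Type v} [AddCommGroup U] [Module Rᵐᵒᵖ U]
  {V : Type w} [AddCommGroup V] [Module Rᵐᵒᵖ V] {α β : Ordinal.{u}}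

/-- If `r(U) ⊄ r(V)`, then `V` has an idempotent representative that annihilates `U`. -/
theorem exists_idempotent_represents_annihilating [IsSimpleModule Rᵐᵒᵖ V]
    (hreg : IsRegularRing R) {y₀ : R}
    (hy₀ : Represents y₀ β V) (hUV : ¬ NatLE R U V) :
    ∃ y : R, IsIdempotentElem y ∧ Represents y β V ∧ ∀ u : U, op y • u = 0 := by
  obtain ⟨a, haU, haV⟩ := SetLike.not_le_iff_exists.mp hUV
  induction a using MulOpposite.rec' with
  | h a =>
    rw [mem_annihilator] at haU haV
    push Not at haV
    obtain ⟨v, hv⟩ := haV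
    obtain ⟨r, hr⟩ := hy₀.exists_mul_mul hreg hv
    obtain ⟨e, he, hep⟩ := exists_idempotent_principal_eq hreg (a * r * y₀)
    refine ⟨e, he, hr.congr hep, ?_⟩
    obtain ⟨s, rfl⟩ := mem_principal.mp (hep ▸ self_mem_principal e)
    exact smul_mul_eq_zero (smul_mul_eq_zero (smul_mul_eq_zero haU r) y₀) s

/-- If `r(U) ⊆ r(V)` and `y ∉ r(V)`, then `yR` contains an independent family of `n` right ideals
isomorphic to one `xR` with `x` representing `U`, and this family is also independent of some `gR`
with `g ∉ r(V)`. -/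
theorem exists_independent_copies [IsSimpleModule Rᵐᵒᵖ U] (hreg : IsRegularRing R) {x₀ y : R}
    (hx₀ : Represents x₀ α U)
    (hUV : NatLE R U V) (hLV : ∀ r ∈ L R (α + 1), ∀ v : V, op r • v = 0) {v : V}
    (hy : op y • v ≠ 0) (n : ℕ) :
    ∃ (x g : R) (t : Fin n → R), Represents x α U ∧ (∀ i, t i ∈ principal y) ∧
      g ∈ principal y ∧ op g • v ≠ 0 ∧
      ∀ a : Fin n → R, (∀ i, a i ∈ principal x) → ∀ b, ∑ i, t i * a i = g * b → ∀ i, a i = 0 := by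
  induction n with
  | zero =>
    exact ⟨x₀, y, Fin.elim0, hx₀, fun i => i.elim0, self_mem_principal y, hy,
      fun _ _ _ _ i => i.elim0⟩
  | succ n ih =>
    obtain ⟨x, g, t, hx, ht, hg, hgv, hind⟩ := ih
    obtain ⟨u, hu⟩ : ∃ u : U, op g • u ≠ 0 := by
      by_contra! hcon
      exact hgv (mem_annihilator.mp (hUV (mem_annihilator.mpr hcon)) v)
    obtain ⟨r, hz⟩ := hx.exists_mul_mul hreg hu
    obtain ⟨z', hz'⟩ := hreg (g * r * x)
    have hkey : g * r * (x * (z' * (g * r * x))) = g * r * x := by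
      simpa only [mul_assoc] using hz'
    have hmem : x * (z' * (g * r * x)) ∈ principal x := mul_mem_principal _ _
    -- With `z = grx`, left multiplication by `gr` maps the new `xR` isomorphically onto `zR`.
    -- Shrinking `x` preserves the old independence, and `g` becomes `(1 - zz')g`, where `zz'` is an
    -- idempotent generating `zR`.
    refine ⟨x * (z' * (g * r * x)), g - g * r * x * z' * g, Fin.cons (g * r) t, ?_, ?_, ?_, ?_, ?_⟩
    · refine hx.of_mem_principal hmem fun hL => hz.2.1 ?_
      rw [← hkey]
      exact mul_mem_L _ hL
    · refine Fin.cases ?_ fun i => ?_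
      · exact mul_mem_right hg r
      · exact ht i
    · refine Submodule.sub_mem _ hg ?_
      simp only [mul_assoc]
      exact mul_mem_right hg _
    · have : op (g * r * x * z' * g) • v = 0 := by
        rw [mul_assoc]
        exact hLV _ (mul_mem_right hz.1 _) v
      rwa [op_sub, sub_smul, this, sub_zero]
    · intro a ha b hab
      rw [Fin.sum_univ_succ] at hab
      simp only [Fin.cons_zero, Fin.cons_succ] at hab
      have htail : ∀ i : Fin n, a i.succ = 0 := by
        refine hind (fun i => a i.succ) (fun i => principal_le.mpr hmem (ha i.succ))
          (b - r * x * z' * g * b - r * a 0) ?_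
        rw [eq_sub_of_add_eq' hab]
        noncomm_ring
      obtain ⟨s, hs⟩ := mem_principal.mp (ha 0)
      refine Fin.cases ?_ htail
      simp only [htail, mul_zero, Finset.sum_const_zero, add_zero] at hab
      have hzs : g * r * x * s = (g - g * r * x * z' * g) * b := by
        rw [← hab, hs, ← mul_assoc, hkey]
      have h0 : g * r * x * s = 0 := by
        -- Left multiplication by `zz'` fixes `zs` but kills `(1 - zz')gb`.
        calc g * r * x * s = g * r * x * z' * (g * r * x * s) := by
              conv_lhs => rw [← hz']
              simp only [mul_assoc]
          _ = (g * r * x * z' - g * r * x * z' * (g * r * x) * z') * g * b := by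
              rw [hzs]
              noncomm_ring
          _ = 0 := by rw [hz', sub_self, zero_mul, zero_mul]
      rw [hs, mul_assoc, mul_assoc, h0, mul_zero, mul_zero]

/-- Independence with `b = 0` says exactly that `a ↦ ∑ tᵢ aᵢ` is injective. -/
theorem exists_represents_embeds [IsSimpleModule Rᵐᵒᵖ U] (hreg : IsRegularRing R) {x₀ y : R}
    (hx₀ : Represents x₀ α U)
    (hUV : NatLE R U V) (hLV : ∀ r ∈ L R (α + 1), ∀ v : V, op r • v = 0) {v : V}
    (hy : op y • v ≠ 0) (n : ℕ) :
    ∃ x : R, IsIdempotentElem x ∧ Represents x α U ∧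
      Embeds Rᵐᵒᵖ (Fin n → principal x) (principal y) := by
  obtain ⟨x, g, t, hx, ht, -, -, hind⟩ := exists_independent_copies hreg hx₀ hUV hLV hy n
  obtain ⟨e, he, hep⟩ := exists_idempotent_principal_eq hreg x
  refine ⟨e, he, hx.congr hep, ?_⟩
  rw [hep]
  let f : (Fin n → principal x) →ₗ[Rᵐᵒᵖ] R :=
    ∑ i, LinearMap.mulLeft Rᵐᵒᵖ (t i) ∘ₗ (principal x).subtype ∘ₗ LinearMap.proj i
  have hf : ∀ a, f a = ∑ i, t i * (a i : R) := fun a => by simp [f]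
  refine ⟨f.codRestrict (principal y) fun a => ?_, ?_⟩
  · rw [hf]
    exact Submodule.sum_mem _ fun i _ => mul_mem_right (ht i) _
  · rw [← LinearMap.ker_eq_bot, LinearMap.ker_codRestrict, LinearMap.ker_eq_bot']
    intro a ha
    rw [hf] at ha
    funext i
    exact Subtype.ext (hind (fun i => a i) (fun i => (a i).2) 0 (by rw [ha, mul_zero]) i)

/-- An embedding of `(xR)^n` into `yR` induces an embedding modulo `L_α`. -/
theorem Embeds.principalMod (hreg : IsRegularRing R) {x y : R} (hx : Represents x α U) {n : ℕ}
    (hxy : Embeds Rᵐᵒᵖ (Fin n → principal x) (principal y)) :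
    Embeds Rᵐᵒᵖ (Fin n → U) (principalMod y α) := by
  obtain ⟨f, hf⟩ := hxy
  obtain ⟨e⟩ := hx.2.2
  have hmem : ∀ (z : R) (p : principal z), (L R α).mkQ p ∈ Semiart.principalMod z α := fun z p =>
    Submodule.mem_map_of_mem (Submodule.mem_sup_left p.2)
  let q (z : R) : principal z →ₗ[Rᵐᵒᵖ] Semiart.principalMod z α :=
    ((L R α).mkQ ∘ₗ (principal z).subtype).codRestrict _ (hmem z)
  have hq : ∀ (z : R) (p : principal z), q z p = 0 ↔ (p : R) ∈ L R α := fun z p => by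
    rw [← mkQ_eq_zero, ← Subtype.coe_inj]
    rfl
  have hqs : ∀ z : R, Function.Surjective (q z) := by
    rintro z ⟨p, hp⟩
    obtain ⟨s, rfl⟩ := mem_principalMod.mp hp
    exact ⟨⟨z * s, mul_mem_principal z s⟩, rfl⟩
  let g : (Fin n → principal x) →ₗ[Rᵐᵒᵖ] (Fin n → U) :=
    LinearMap.pi fun i => e.toLinearMap ∘ₗ q x ∘ₗ LinearMap.proj i
  have hg : Function.Surjective g := fun u => by
    choose p hp using fun i => hqs x (e.symm (u i))
    exact ⟨p, funext fun i => by simp [g, hp]⟩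
  -- Both kernels consist of the families with all entries in `L R α`: regularity makes `f(a)` a sum
  -- of left multiples of the entries `aᵢ`, and each `aᵢ` a left multiple of `f(a)`.
  have hker : LinearMap.ker g = LinearMap.ker (q y ∘ₗ f) := by
    ext a
    have hga : a ∈ LinearMap.ker g ↔ ∀ i, (a i : R) ∈ L R α := by
      simp only [LinearMap.mem_ker, funext_iff, ← hq]
      simp [g]
    rw [hga, LinearMap.mem_ker, LinearMap.comp_apply, hq]
    constructor
    · intro ha
      have hfa : f a = ∑ i, f (Pi.single i (a i)) := by
        rw [← map_sum, Finset.univ_sum_single]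
      rw [hfa, AddSubmonoidClass.coe_finsetSum]
      refine Submodule.sum_mem _ fun i _ => ?_
      obtain ⟨a', ha'⟩ := hreg (a i : R)
      have : (a i) = op (a' * (a i : R)) • a i := Subtype.ext (by
        rw [Submodule.coe_smul, op_smul_eq_mul, ← mul_assoc, ha'])
      rw [this, Pi.single_smul, map_smul, Submodule.coe_smul, op_smul_eq_mul]
      exact mul_mem_L _ (mul_mem_L _ (ha i))
    · intro hfa i
      obtain ⟨w', hw'⟩ := exists_smul_eq_self hreg hf a
      have hi := congrArg (fun b : Fin n → principal x => (b i : R)) hw'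
      rw [← hi, Pi.smul_apply, Submodule.coe_smul, op_smul_eq_mul]
      exact mul_mem_L _ (mul_mem_L _ hfa)
  let k := (LinearMap.ker g).liftQ (q y ∘ₗ f) hker.le
  have hk : Function.Injective k :=
    LinearMap.ker_eq_bot.mp (Submodule.ker_liftQ_eq_bot _ _ _ hker.ge)
  exact ⟨k ∘ₗ (g.quotKerEquivOfSurjective hg).symm.toLinearMap,
    hk.comp (g.quotKerEquivOfSurjective hg).symm.injective⟩

/-- If `y` annihilates `U`, then `U` does not embed in `(yR + L_α) / L_α`. -/
theorem not_injective_of_annihilating (hreg : IsRegularRing R) [Nontrivial U] {y : R}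
    (hy : ∀ u : U, op y • u = 0) (f : U →ₗ[Rᵐᵒᵖ] principalMod y α) : ¬ Function.Injective f := by
  intro hf
  obtain ⟨u, hu⟩ := exists_ne (0 : U)
  obtain ⟨s, hs⟩ := mem_principalMod.mp (f u).2
  -- `z'ys` fixes the class of `ys`, which is `f u`, so by injectivity it fixes `u`; but it kills
  -- `U` because `y` does.
  obtain ⟨z', hz'⟩ := hreg (y * s)
  have h0 : op (z' * (y * s)) • u = 0 := smul_mul_eq_zero' (smul_mul_eq_zero hy s) z' u
  have h1 : op (z' * (y * s)) • u = u := hf (Subtype.ext (by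
    rw [map_smul, Submodule.coe_smul, hs, ← map_smul, op_smul_eq_mul, ← mul_assoc, hz']))
  exact hu (h1 ▸ h0)

/-- Regularity gives `x = x w' f(x)` with `f(x) ∈ yR`. -/
theorem mem_span_of_embeds (hreg : IsRegularRing R) {x y : R}
    (hxy : Embeds Rᵐᵒᵖ (Fin 1 → principal x) (principal y)) : x ∈ TwoSidedIdeal.span {y} := by
  obtain ⟨f, hf⟩ := hxy
  obtain ⟨w', hw'⟩ := exists_smul_eq_self hreg hf fun _ => ⟨x, self_mem_principal x⟩
  have hx := congrArg (fun b : Fin 1 → principal x => (b 0 : R)) hw'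
  obtain ⟨s, hs⟩ := mem_principal.mp (f fun _ => ⟨x, self_mem_principal x⟩).2
  rw [hs, Pi.smul_apply, Submodule.coe_smul, op_smul_eq_mul] at hx
  have hy : y ∈ TwoSidedIdeal.span {y} := TwoSidedIdeal.subset_span rfl
  rw [← show x * (w' * (y * s)) = x from hx]
  exact TwoSidedIdeal.mul_mem_left _ _ _ (TwoSidedIdeal.mul_mem_left _ _ _
    (TwoSidedIdeal.mul_mem_right _ _ _ hy))

end Main

end Ring

end Semiart

open Semiart

/-! ### The equivalence. -/

theorem mainTheorem4 {R : Type u} [Ring R]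
    (hreg : Semiart.IsRegularRing R) (hsemi : Semiart.IsRightSemiartinian R)
    (U : Type v) [AddCommGroup U] [Module Rᵐᵒᵖ U] [IsSimpleModule Rᵐᵒᵖ U]
    (V : Type w) [AddCommGroup V] [Module Rᵐᵒᵖ V] [IsSimpleModule Rᵐᵒᵖ V]
    (α β : Ordinal.{u})
    (hU : Semiart.h R U = α + 1) (hV : Semiart.h R V = β + 1) (hlt : α + 1 < β + 1) :
    -- suitable idempotents exist
    (∃ x : R, IsIdempotentElem x ∧ Semiart.Represents x α U) ∧
    (∃ y : R, IsIdempotentElem y ∧ Semiart.Represents y β V) ∧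
    -- the equivalence, with `x` and `y` ranging, independently, over all elements or all idempotents
    (∀ X Y : Set R,
      (X = Set.univ ∨ X = {e | IsIdempotentElem e}) →
      (Y = Set.univ ∨ Y = {e | IsIdempotentElem e}) →
      List.TFAE [
        Semiart.NatLT R U V,
        ∀ y ∈ Y, Semiart.Represents y β V →
          ∀ n : ℕ, 0 < n → Semiart.Embeds Rᵐᵒᵖ (Fin n → U) (Semiart.principalMod y α),
        ∀ y ∈ Y, Semiart.Represents y β V →
          ∀ n : ℕ, 0 < n → ∃ x ∈ X, Semiart.Represents x α U ∧
            Semiart.Embeds Rᵐᵒᵖ (Fin n → Semiart.principal x) (Semiart.principal y),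
        ∀ y ∈ Y, Semiart.Represents y β V →
          ∃ x ∈ X, Semiart.Represents x α U ∧
            TwoSidedIdeal.span {x} ≤ TwoSidedIdeal.span {y}]) := by
  obtain ⟨x₀, hx₀⟩ := exists_represents hU
  obtain ⟨y₀, hy₀⟩ := exists_represents hV
  have hαβ : α + 1 ≤ β := Order.lt_add_one_iff.mp hlt
  have hLV : ∀ r ∈ L R (α + 1), ∀ v : V, MulOpposite.op r • v = 0 := fun r hr v =>
    hy₀.smul_eq_zero (loewy_mono hαβ hr) v
  refine ⟨?_, ?_, ?_⟩
  · obtain ⟨e, he, hep⟩ := exists_idempotent_principal_eq hreg x₀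
    exact ⟨e, he, hx₀.congr hep⟩
  · obtain ⟨e, he, hep⟩ := exists_idempotent_principal_eq hreg y₀
    exact ⟨e, he, hy₀.congr hep⟩
  intro X Y hX hY
  -- Every element constructed below is idempotent, so all choices of `X` and `Y` are handled at
  -- once.
  have hmemX : ∀ e : R, IsIdempotentElem e → e ∈ X := fun e he => by
    rcases hX with rfl | rfl
    exacts [Set.mem_univ e, he]
  have hmemY : ∀ e : R, IsIdempotentElem e → e ∈ Y := fun e he => by
    rcases hY with rfl | rfl
    exacts [Set.mem_univ e, he]
  -- `x₀ ∈ L R (α + 1)` kills `V` but not `U`.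
  have hnot : ¬ NatLE R V U := fun hVU => by
    obtain ⟨u, hu⟩ := hx₀.exists_smul_ne_zero hreg
    exact hu (mem_annihilator.mp (hVU (mem_annihilator.mpr (hLV _ hx₀.1))) u)
  have := IsSimpleModule.nontrivial Rᵐᵒᵖ U
  tfae_have 1 → 3 := by
    intro hUV y _ hy n _
    obtain ⟨v, hv⟩ := hy.exists_smul_ne_zero hreg
    obtain ⟨x, hx, hxU, hxy⟩ := exists_represents_embeds hreg hx₀ hUV.1 hLV hv n
    exact ⟨x, hmemX x hx, hxU, hxy⟩
  tfae_have 3 → 2 := by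
    intro h3 y hyY hy n hn
    obtain ⟨x, _, hx, hxy⟩ := h3 y hyY hy n hn
    exact hxy.principalMod hreg hx
  tfae_have 2 → 1 := by
    intro h2
    refine ⟨by_contra fun hUV => ?_, hnot⟩
    obtain ⟨y, hyi, hy, hyU⟩ := exists_idempotent_represents_annihilating hreg hy₀ hUV
    obtain ⟨f, hf⟩ := h2 y (hmemY y hyi) hy 1 one_pos
    let e : U ≃ₗ[Rᵐᵒᵖ] (Fin 1 → U) := (LinearEquiv.funUnique (Fin 1) Rᵐᵒᵖ U).symm
    exact not_injective_of_annihilating hreg hyU (f ∘ₗ e.toLinearMap) (hf.comp e.injective)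
  tfae_have 3 → 4 := by
    intro h3 y hyY hy
    obtain ⟨x, hxX, hx, hxy⟩ := h3 y hyY hy 1 one_pos
    refine ⟨x, hxX, hx, TwoSidedIdeal.span_le.mpr ?_⟩
    exact Set.singleton_subset_iff.mpr (mem_span_of_embeds hreg hxy)
  tfae_have 4 → 1 := by
    intro h4
    refine ⟨by_contra fun hUV => ?_, hnot⟩
    obtain ⟨y, hyi, hy, hyU⟩ := exists_idempotent_represents_annihilating hreg hy₀ hUV
    obtain ⟨x, _, hx, hxy⟩ := h4 y (hmemY y hyi) hy
    obtain ⟨u, hu⟩ := hx.exists_smul_ne_zero hreg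
    exact hu (smul_eq_zero_of_mem_span hyU (hxy (TwoSidedIdeal.subset_span rfl)) u)
  tfae_finish
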